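/- Let $X$ be a geodesic metric space which is Gromov hyperbolic, and let a group $G$ act on $X$ by isometries. Let $Y=\{Y_i\}_{i\in I}$ be a collection of nonempty subsets of $X$ that is $G$-equivariant (if $h\in G$ and $Y_i\in Y$, then $hY_i\in Y$) and uniformly quasiconvex (there is a constant $K$ such that for every $i$ each geodesic of $X$ with endpoints in $Y_i$ lies in the $K$-neighbourhood of $Y_i$). The electrification $X_Y$ is the metric space obtained from $X$ by adding, for each set $Y_i$, a new vertex $y_i$ and an edge of length $\tfrac12$ from each point $y\in Y_i$ to $y_i$, with the induced path metric. The group $G$ acts on $X_Y$ by extending its action on $X$: $h$ maps the vertex of $Y_i$ to the vertex of $hY_i$, and the edge from $y\in Y_i$ to the edge from $hy\in hY_i$. For an isometric action of $G$ on a metric space $(Z,d)$, an element $g\in G$ is loxodromic if for every $z\in Z$ the map $\mathbb Z\to Z$, $n\mapsto g^nz$, is a quasi-isometric embedding. It is WPD if it is loxodromic and for every $r>0$ and $z\in Z$ there is $N\in\mathbb N$ such that the set $\{h\in G : d(z,hz)<r \text{ and } d(g^Nz,hg^Nz)<r\}$ is finite. Let $g\in G$ be loxodromic and WPD on $X$.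 Let $\alpha$ be a quasi-geodesic axis of $g$, that is, the image of a quasi-isometric embedding $\mathbb R\to X$ with $g\alpha=\alpha$. Let $\pi_\alpha\colon X\to\alpha$ be a nearest-point projection, where an additive error is allowed: for some constant $c\ge 0$, $d(x,\pi_\alpha(x))\le d(x,\alpha)+c$ for all $x\in X$. Suppose that there is a constant $C>0$ such that $\operatorname{diam}_X(\pi_\alpha(Y_i))<C$ for every $Y_i\in Y$. Then $g$ is WPD (in particular loxodromic) on the electrification $X_Y$. -/

import Mathlib

open scoped Pointwise

/-- A quasi-isometric embedding `f : X → Z`: for some constants `K ≥ 1` and `c ≥ 0`,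
`d(a,b)/K - c ≤ d(f a, f b) ≤ K d(a,b) + c`. -/
def IsQuasiIsometricEmbedding {X Z : Type*} [PseudoMetricSpace X] [PseudoMetricSpace Z]
    (f : X → Z) : Prop :=
  ∃ K c : ℝ, 1 ≤ K ∧ 0 ≤ c ∧ ∀ a b : X,
    dist a b / K - c ≤ dist (f a) (f b) ∧ dist (f a) (f b) ≤ K * dist a b + c

/-- `γ` restricted to `[0, L]` is a geodesic segment from `x` to `y`. -/
structure IsGeodesicSegment {X : Type*} [PseudoMetricSpace X] (γ : ℝ → X) (L : ℝ) (x y : X) :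
    Prop where
  nonneg : 0 ≤ L
  source : γ 0 = x
  target : γ L = y
  isometric : ∀ s ∈ Set.Icc 0 L, ∀ t ∈ Set.Icc 0 L, dist (γ s) (γ t) = |s - t|

/-- Any two points are joined by a geodesic segment. -/
def IsGeodesicSpace (X : Type*) [PseudoMetricSpace X] : Prop :=
  ∀ x y : X, ∃ (γ : ℝ → X) (L : ℝ), IsGeodesicSegment γ L x y

/-- Gromov hyperbolicity, by the four-point condition. -/
def IsGromovHyperbolic (X : Type*) [PseudoMetricSpace X] : Prop :=
  ∃ δ : ℝ, ∀ x y z w : X,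
    dist x y + dist z w ≤ max (dist x z + dist y w) (dist x w + dist y z) + 2 * δ

/-- A family of sets is uniformly quasiconvex if, for one constant `K`, every geodesic segment
with endpoints in a member `A` of the family lies in the `K`-neighbourhood of `A`. -/
def UniformlyQuasiconvex {X : Type*} [PseudoMetricSpace X] (Y : Set (Set X)) : Prop :=
  ∃ K : ℝ, ∀ A ∈ Y, ∀ a ∈ A, ∀ b ∈ A, ∀ (γ : ℝ → X) (L : ℝ), IsGeodesicSegment γ L a b →
    ∀ t ∈ Set.Icc 0 L, ∃ p ∈ A, dist (γ t) p ≤ K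

/-- `g` acts loxodromically: every orbit map `n ↦ gⁿ x` is a quasi-isometric embedding of `ℤ`. -/
def IsLoxodromic {G : Type*} (X : Type*) [Group G] [PseudoMetricSpace X] [MulAction G X]
    (g : G) : Prop :=
  ∀ x : X, IsQuasiIsometricEmbedding (fun n : ℤ => g ^ n • x)

/-- `g` is loxodromic and acts weakly properly discontinuously on `X`. -/
def IsWPD {G : Type*} (X : Type*) [Group G] [PseudoMetricSpace X] [MulAction G X]
    (g : G) : Prop :=
  IsLoxodromic X g ∧ ∀ r : ℝ, 0 < r → ∀ x : X, ∃ N : ℕ,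
    {h : G | dist x (h • x) < r ∧ dist (g ^ N • x) (h • g ^ N • x) < r}.Finite

/-- `α` is a quasi-geodesic axis of `g`: a bi-infinite quasi-geodesic (not necessarily
continuous) whose image is invariant under `g`. -/
def IsQuasiAxis {G X : Type*} [Group G] [PseudoMetricSpace X] [MulAction G X]
    (g : G) (α : ℝ → X) : Prop :=
  IsQuasiIsometricEmbedding α ∧ g • Set.range α = Set.range α

/-- `π` is a nearest-point projection to `S`, up to an additive error: each point is sent to a
point of `S` which realizes the distance to `S` up to a uniform constant `c`. For `c = 0` it is an
exact nearest-point projection; a positive `c` is allowed since exact nearest points need not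
exist. -/
def IsNearestPointProjection {X : Type*} [PseudoMetricSpace X] (S : Set X) (π : X → X) : Prop :=
  ∃ c : ℝ, 0 ≤ c ∧ ∀ x : X, π x ∈ S ∧ dist x (π x) ≤ Metric.infDist x S + c

/-- A family of nonempty subsets of `X` which is `G`-equivariant: `g A` belongs to the family
whenever `A` does. -/
structure EquivariantFamily (G X : Type*) [Group G] [MulAction G X] where
  sets : Set (Set X)
  nonempty : ∀ A ∈ sets, A.Nonempty
  smul_mem : ∀ (g : G), ∀ A ∈ sets, g • A ∈ sets

/-- The points of the electrification of `X` with respect to `Y`: the points of `X`, one cone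
vertex for each `A ∈ Y`, and, for each `A ∈ Y` and `a ∈ A`, the interior points of an edge of length
`1/2` from `a` to the cone vertex of `A`, parametrized by the distance `t` from `a`. -/
inductive Electrification {X : Type*} (Y : Set (Set X)) where
  | base (x : X) : Electrification Y
  | cone (A : Set X) (hA : A ∈ Y) : Electrification Y
  | edge (A : Set X) (hA : A ∈ Y) (a : X) (ha : a ∈ A) (t : ℝ) (ht : t ∈ Set.Ioo (0 : ℝ) (1 / 2)) :
      Electrification Y

namespace Electrification

open Classical in
/-- The point at distance `t ∈ [0, 1/2]` from `a` on the closed edge from `a` to the cone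
vertex of `A`. -/
noncomputable def edgePoint {X : Type*} {Y : Set (Set X)} (A : Set X) (hA : A ∈ Y) (a : X)
    (ha : a ∈ A) (t : ℝ) : Electrification Y :=
  if h : t ∈ Set.Ioo (0 : ℝ) (1 / 2) then edge A hA a ha t h
  else if t ≤ 0 then base a else cone A hA

/-- `IsPath p q l`: there is a path of length `l` from `p` to `q`, made of finitely many pieces,
each of which is either in `X` (and then has the length of a shortest path of `X` between its
endpoints) or a subsegment of one of the attached edges. -/
inductive IsPath {X : Type*} [PseudoMetricSpace X] {Y : Set (Set X)} :
    Electrification Y → Electrification Y → ℝ → Prop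
  | refl (p : Electrification Y) : IsPath p p 0
  | base_step {p : Electrification Y} {l : ℝ} (x y : X) (h : IsPath p (base x) l) :
      IsPath p (base y) (l + dist x y)
  | edge_step {p : Electrification Y} {l : ℝ} (A : Set X) (hA : A ∈ Y) (a : X) (ha : a ∈ A)
      (s t : ℝ) (hs : s ∈ Set.Icc (0 : ℝ) (1 / 2)) (ht : t ∈ Set.Icc (0 : ℝ) (1 / 2))
      (h : IsPath p (edgePoint A hA a ha s) l) :
      IsPath p (edgePoint A hA a ha t) (l + |s - t|)

/-- The path metric: the infimum of the lengths of the paths. -/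
noncomputable instance instDist {X : Type*} [PseudoMetricSpace X] {Y : Set (Set X)} :
    Dist (Electrification Y) :=
  ⟨fun p q => sInf {l : ℝ | IsPath p q l}⟩

section paths

variable {X : Type*} {Y : Set (Set X)}

@[simp] theorem edgePoint_zero (A : Set X) (hA : A ∈ Y) (a : X) (ha : a ∈ A) :
    edgePoint A hA a ha 0 = base a := by
  simp [edgePoint]

@[simp] theorem edgePoint_half (A : Set X) (hA : A ∈ Y) (a : X) (ha : a ∈ A) :
    edgePoint A hA a ha (1 / 2) = cone A hA := by
  simp [edgePoint]

theorem edgePoint_of_mem (A : Set X) (hA : A ∈ Y) (a : X) (ha : a ∈ A) (t : ℝ)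
    (ht : t ∈ Set.Ioo (0 : ℝ) (1 / 2)) : edgePoint A hA a ha t = edge A hA a ha t ht := by
  rw [edgePoint, dif_pos ht]

theorem edgePoint_cases (A : Set X) (hA : A ∈ Y) (a : X) (ha : a ∈ A) (t : ℝ)
    (ht : t ∈ Set.Icc (0 : ℝ) (1 / 2)) :
    (t = 0 ∧ edgePoint A hA a ha t = base a) ∨
    (t = 1 / 2 ∧ edgePoint A hA a ha t = cone A hA) ∨
    (∃ h : t ∈ Set.Ioo (0 : ℝ) (1 / 2), edgePoint A hA a ha t = edge A hA a ha t h) := by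
  rcases ht.1.eq_or_lt with h0 | h0
  · subst h0; simp
  rcases ht.2.eq_or_lt with h1 | h1
  · subst h1; right; left; exact ⟨rfl, edgePoint_half ..⟩
  · right; right; exact ⟨⟨h0, h1⟩, edgePoint_of_mem ..⟩

variable [PseudoMetricSpace X]

theorem IsPath.nonneg {p q : Electrification Y} {l : ℝ} (h : IsPath p q l) : 0 ≤ l := by
  induction h with
  | refl => exact le_rfl
  | base_step x y _ ih => positivity
  | edge_step A hA a ha s t hs ht _ ih => positivity

theorem IsPath.trans {p q r : Electrification Y} {l m : ℝ} (h : IsPath p q l)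
    (h' : IsPath q r m) : IsPath p r (l + m) := by
  induction h' with
  | refl => simpa using h
  | base_step x y _ ih => rw [← add_assoc]; exact ih.base_step x y
  | edge_step A hA a ha s t hs ht _ ih =>
    rw [← add_assoc]; exact ih.edge_step A hA a ha s t hs ht

theorem isPath_base (x y : X) : IsPath (base x : Electrification Y) (base y) (dist x y) := by
  simpa using (IsPath.refl (base x : Electrification Y)).base_step x y

theorem isPath_edge (A : Set X) (hA : A ∈ Y) (a : X) (ha : a ∈ A)
    (s t : ℝ) (hs : s ∈ Set.Icc (0 : ℝ) (1 / 2)) (ht : t ∈ Set.Icc (0 : ℝ) (1 / 2)) :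
    IsPath (edgePoint A hA a ha s) (edgePoint A hA a ha t) |s - t| := by
  simpa using (IsPath.refl (edgePoint A hA a ha s)).edge_step A hA a ha s t hs ht

theorem IsPath.symm {p q : Electrification Y} {l : ℝ} (h : IsPath p q l) : IsPath q p l := by
  induction h with
  | refl => exact .refl _
  | base_step x y _ ih => rw [add_comm, dist_comm]; exact (isPath_base y x).trans ih
  | edge_step A hA a ha s t hs ht _ ih =>
    rw [add_comm, abs_sub_comm]; exact (isPath_edge A hA a ha t s ht hs).trans ih

theorem bddBelow_isPath (p q : Electrification Y) : BddBelow {l : ℝ | IsPath p q l} :=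
  ⟨0, fun _ h => h.nonneg⟩

theorem exists_isPath_base (hY : ∀ A ∈ Y, A.Nonempty) (p : Electrification Y) :
    ∃ (x : X) (l : ℝ), IsPath p (base x) l := by
  cases p with
  | base x => exact ⟨x, 0, .refl _⟩
  | cone A hA =>
    obtain ⟨a, ha⟩ := hY A hA
    refine ⟨a, |1 / 2 - 0|, ?_⟩
    simpa only [edgePoint_zero, edgePoint_half] using
      isPath_edge A hA a ha (1 / 2) 0 (by norm_num) (by norm_num)
  | edge A hA a ha t ht =>
    refine ⟨a, |t - 0|, ?_⟩
    simpa only [edgePoint_zero, edgePoint_of_mem _ _ _ _ t ht] using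
      isPath_edge A hA a ha t 0 (Set.Ioo_subset_Icc_self ht) (by norm_num)

theorem exists_isPath (hY : ∀ A ∈ Y, A.Nonempty) (p q : Electrification Y) :
    {l : ℝ | IsPath p q l}.Nonempty := by
  obtain ⟨x, l, hx⟩ := exists_isPath_base hY p
  obtain ⟨y, m, hy⟩ := exists_isPath_base hY q
  exact ⟨_, (hx.trans (isPath_base x y)).trans hy.symm⟩

/-- A function which is `1`-Lipschitz on `X` and on each edge is `1`-Lipschitz along paths. -/
theorem IsPath.le_of_lipschitz (f : Electrification Y → ℝ)
    (hX : ∀ x y : X, f (base y) ≤ f (base x) + dist x y)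
    (hE : ∀ (A : Set X) (hA : A ∈ Y) (a : X) (ha : a ∈ A), ∀ s ∈ Set.Icc (0 : ℝ) (1 / 2),
      ∀ t ∈ Set.Icc (0 : ℝ) (1 / 2),
      f (edgePoint A hA a ha t) ≤ f (edgePoint A hA a ha s) + |s - t|)
    {p q : Electrification Y} {l : ℝ} (h : IsPath p q l) : f q ≤ f p + l := by
  induction h with
  | refl => simp
  | base_step x y _ ih => linarith [hX x y]
  | edge_step A hA a ha s t hs ht _ ih => linarith [hE A hA a ha s hs t ht]

end paths

open Classical in
/-- A function which is positive except at `p` and `1`-Lipschitz on `X` and on each edge. -/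
noncomputable def sepFun {X : Type*} [PseudoMetricSpace X] {Y : Set (Set X)} :
    Electrification Y → Electrification Y → ℝ
  | base x, base y => min (dist x y) (1 / 2)
  | base _, cone _ _ => 1 / 2
  | base x, edge _ _ a _ t _ => min (dist x a + t) (1 / 2)
  | cone _ _, base _ => 1 / 2
  | cone A _, cone B _ => if A = B then 0 else 1 / 2
  | cone A _, edge B _ _ _ t _ => if A = B then 1 / 2 - t else 1 / 2
  | edge _ _ _ _ t _, base _ => min t (1 / 2 - t)
  | edge _ _ _ _ t _, cone _ _ => min t (1 / 2 - t)
  | edge A _ a _ t _, edge B _ b _ s _ =>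
      if A = B ∧ a = b then min |s - t| (min t (1 / 2 - t)) else min t (1 / 2 - t)

theorem sepFun_self {X : Type*} [PseudoMetricSpace X] {Y : Set (Set X)} (p : Electrification Y) :
    sepFun p p = 0 := by
  cases p with
  | base x => simp [sepFun]
  | cone A hA => simp [sepFun]
  | edge A hA a ha t ht =>
    simp only [sepFun, and_self, if_true, sub_self, abs_zero]
    exact min_eq_left (le_min ht.1.le (by linarith [ht.2]))

theorem eq_of_sepFun_nonpos {X : Type*} [MetricSpace X] {Y : Set (Set X)}
    (p q : Electrification Y) (h : sepFun p q ≤ 0) : p = q := by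
  cases p with
  | base x =>
    cases q with
    | base y =>
      simp only [sepFun, min_le_iff] at h
      rcases h with h | h
      · rw [dist_le_zero.1 h]
      · norm_num at h
    | cone B hB => norm_num [sepFun] at h
    | edge B hB b hb s hs =>
      simp only [sepFun, min_le_iff] at h
      rcases h with h | h
      · linarith [hs.1, dist_nonneg (x := x) (y := b)]
      · norm_num at h
  | cone A hA =>
    cases q with
    | base y => norm_num [sepFun] at h
    | cone B hB =>
      by_cases hAB : A = B
      · subst hAB; rfl
      · norm_num [sepFun, hAB] at h
    | edge B hB b hb s hs =>
      simp only [sepFun] at h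
      split_ifs at h
      · linarith [hs.2]
      · norm_num at h
  | edge A hA a ha t ht =>
    have hm : 0 < min t (1 / 2 - t) := lt_min ht.1 (by linarith [ht.2])
    cases q with
    | base y => exact absurd h (not_le.2 hm)
    | cone B hB => exact absurd h (not_le.2 hm)
    | edge B hB b hb s hs =>
      simp only [sepFun] at h
      split_ifs at h with hc
      · obtain ⟨rfl, rfl⟩ := hc
        rcases min_le_iff.1 h with h | h
        · have : s = t := by linarith [abs_nonpos_iff.1 h]
          subst this; rfl
        · exact absurd h (not_le.2 hm)
      · exact absurd h (not_le.2 hm)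

theorem sepFun_le {X : Type*} [PseudoMetricSpace X] {Y : Set (Set X)}
    (o : Electrification Y) {p q : Electrification Y} {l : ℝ} (h : IsPath p q l) :
    sepFun o q ≤ sepFun o p + l := by
  refine h.le_of_lipschitz (sepFun o) (fun x y => ?_) (fun A hA a ha s hs t ht => ?_)
  · cases o with
    | base z =>
      simp only [sepFun]
      have := dist_triangle z x y
      have := dist_nonneg (x := x) (y := y)
      simp only [min_def]
      split_ifs <;> linarith
    | cone B hB => simp [sepFun]
    | edge B hB b hb u hu => simp [sepFun]
  · have h1 := hs.1
    have h2 := hs.2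
    have h3 := ht.1
    have h4 := ht.2
    have h5 := le_abs_self (s - t)
    have h6 := neg_le_abs (s - t)
    have h7 := abs_nonneg (s - t)
    rcases edgePoint_cases A hA a ha s hs with ⟨hs', es⟩ | ⟨hs', es⟩ | ⟨hs', es⟩ <;>
    rcases edgePoint_cases A hA a ha t ht with ⟨ht', et⟩ | ⟨ht', et⟩ | ⟨ht', et⟩ <;>
    rw [es, et] <;> clear es et
    all_goals
      cases o with
      | base x =>
        have := dist_nonneg (x := x) (y := a)
        simp only [sepFun, min_def]
        (try split_ifs) <;> linarith
      | cone B hB =>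
        simp only [sepFun]
        (try split_ifs) <;> linarith
      | edge B hB b hb u hu =>
        have h8 := le_abs_self (t - u)
        have h9 := neg_le_abs (t - u)
        have h10 := abs_sub_le t s u
        rw [abs_sub_comm t s] at h10
        have h11 := le_abs_self (s - u)
        have h12 := neg_le_abs (s - u)
        simp only [sepFun, min_def]
        (try split_ifs) <;> linarith

/-- The electrification along nonempty sets is a metric space with its path metric. -/
noncomputable instance instMetricSpace {G X : Type*} [Group G] [MetricSpace X] [MulAction G X]
    (Y : EquivariantFamily G X) : MetricSpace (Electrification Y.sets) where
  dist_self p := le_antisymm (csInf_le (bddBelow_isPath p p) (.refl p))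
    (le_csInf (exists_isPath Y.nonempty p p) fun _ h => h.nonneg)
  dist_comm p q := congrArg sInf (Set.ext fun _ => ⟨fun h => h.symm, fun h => h.symm⟩)
  dist_triangle p q r := by
    refine le_of_forall_pos_le_add fun ε hε => ?_
    obtain ⟨l, hl, hl'⟩ := Real.lt_sInf_add_pos (exists_isPath Y.nonempty p q) (half_pos hε)
    obtain ⟨m, hm, hm'⟩ := Real.lt_sInf_add_pos (exists_isPath Y.nonempty q r) (half_pos hε)
    have : sInf {l : ℝ | IsPath p r l} ≤ l + m := csInf_le (bddBelow_isPath p r) (hl.trans hm)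
    change sInf {l : ℝ | IsPath p r l} ≤
      sInf {l : ℝ | IsPath p q l} + sInf {l : ℝ | IsPath q r l} + ε
    linarith
  eq_of_dist_eq_zero {p q} h := by
    refine eq_of_sepFun_nonpos p q (le_of_le_of_eq ?_ h)
    refine le_csInf (exists_isPath Y.nonempty p q) fun l hl => ?_
    simpa [sepFun_self] using sepFun_le p hl

/-- The action of `G` on the electrification: `g` acts as given on `X`, sends the cone vertex of
`A` to that of `g A`, and the edge from `a` to the cone vertex of `A` to the edge from `g a` to
the cone vertex of `g A`. -/
instance instMulAction {G X : Type*} [Group G] [MulAction G X] (Y : EquivariantFamily G X) :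
    MulAction G (Electrification Y.sets) where
  smul g p := match p with
    | base x => base (g • x)
    | cone A hA => cone (g • A) (Y.smul_mem g A hA)
    | edge A hA a ha t ht =>
      edge (g • A) (Y.smul_mem g A hA) (g • a) (Set.smul_mem_smul_set ha) t ht
  one_smul p := by
    cases p with
    | base x => exact congrArg base (one_smul G x)
    | cone A hA =>
      change cone _ _ = cone _ _
      simp only [one_smul]
    | edge A hA a ha t ht =>
      change edge _ _ _ _ _ _ = edge _ _ _ _ _ _
      simp only [one_smul]
  mul_smul g h p := by
    cases p with
    | base x => exact congrArg base (mul_smul g h x)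
    | cone A hA =>
      change cone _ _ = cone _ _
      simp only [mul_smul]
    | edge A hA a ha t ht =>
      change edge _ _ _ _ _ _ = edge _ _ _ _ _ _
      simp only [mul_smul]

theorem smul_edgePoint {G X : Type*} [Group G] [MulAction G X] (Y : EquivariantFamily G X) (g : G)
    (A : Set X) (hA : A ∈ Y.sets) (a : X) (ha : a ∈ A) (t : ℝ) :
    g • edgePoint A hA a ha t =
      edgePoint (g • A) (Y.smul_mem g A hA) (g • a) (Set.smul_mem_smul_set ha) t := by
  unfold edgePoint
  split_ifs <;> rfl

theorem IsPath.smul {G X : Type*} [Group G] [MetricSpace X] [MulAction G X] [IsIsometricSMul G X]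
    {Y : EquivariantFamily G X} (g : G) {p q : Electrification Y.sets} {l : ℝ}
    (h : IsPath p q l) : IsPath (g • p) (g • q) l := by
  induction h with
  | refl => exact .refl _
  | base_step x y _ ih =>
    rw [← dist_smul g x y]
    exact ih.base_step (g • x) (g • y)
  | edge_step A hA a ha s t hs ht _ ih =>
    rw [smul_edgePoint] at ih ⊢
    exact ih.edge_step _ _ _ _ s t hs ht

/-- If `G` acts on `X` by isometries, so does it on the electrification. -/
instance instIsIsometricSMul {G X : Type*} [Group G] [MetricSpace X] [MulAction G X]
    [IsIsometricSMul G X] (Y : EquivariantFamily G X) :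
    IsIsometricSMul G (Electrification Y.sets) where
  isometry_smul g := Isometry.of_dist_eq fun p q =>
    congrArg sInf (Set.ext fun _ =>
      ⟨fun h => by simpa only [inv_smul_smul, Set.mem_ofPred_eq] using h.smul g⁻¹, fun h => h.smul g⟩)

end Electrification

/-!
The nearest-point projection `π` to the axis survives the electrification. By stability of
quasi-geodesics the axis `α` is quasiconvex, so in the hyperbolic space `X` the projection `π` is
strongly contracting (`FourPoint.exists_contracting`): whenever `π x` and `π y` are far apart,
passing through them is nearly the shortest way from `x` to `y`. In particular `π` is coarsely
`1`-Lipschitz, and as it sends every set of the family to a set of bounded diameter, it is still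
coarsely Lipschitz for the smaller metric of the electrification
(`Electrification.dist_map_le_mul_dist_base`). Hence `α` stays quasi-isometrically embedded and `g`
stays loxodromic.

For WPD, let `x₀ ∈ α` and suppose that `h` moves `x₀` and `gᴺ x₀` by less than `r` in the
electrification. The projections of `h x₀` and `h gᴺ x₀` are within a bounded distance, in `X`, of
`x₀` and `gᴺ x₀`, so for large `N` they are far apart. By contraction they lie near a geodesic from
`h x₀` to `h gᴺ x₀`, and so near `hα`. Therefore `x₀` is `X`-close to a point `h p` with `p ∈ α`; this
`p` is close to `x₀` in the electrification, since `h` moves `x₀` little there, hence in `X`, since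
`α` is quasi-isometrically embedded. Thus `h` moves `x₀`, and likewise `gᴺ x₀`, by an amount in `X`
that is bounded independently of `N`. It then also moves `g^N₀ x₀` by a bounded amount for each
`N₀ ≤ N` (`FourPoint.exists_dist_zpow_smul_le`), and choosing `N₀` by WPD on `X` leaves finitely
many such `h`.

Stability of quasi-geodesics (`FourPoint.exists_dist_quasiGeodesic_le`) is derived from the
four-point condition alone: along a chain of `n` points the Gromov product, seen from a fixed point,
drops by at most `δ ⌈log₂ n⌉`.
-/

/-! ### Gromov products in hyperbolic spaces -/

/-- The Gromov product `(x | y)_p`. -/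
noncomputable def gromovProduct {X : Type*} [PseudoMetricSpace X] (p x y : X) : ℝ :=
  (dist p x + dist p y - dist x y) / 2

/-- The four-point condition with a fixed constant `δ`. -/
def FourPoint (X : Type*) [PseudoMetricSpace X] (δ : ℝ) : Prop :=
  ∀ x y z w : X, dist x y + dist z w ≤ max (dist x z + dist y w) (dist x w + dist y z) + 2 * δ

section Hyperbolic

variable {X : Type*} [PseudoMetricSpace X] {δ : ℝ}

theorem FourPoint.nonneg (h : FourPoint X δ) (x : X) : 0 ≤ δ := by
  have := h x x x x
  simp only [dist_self, add_zero, max_self, zero_add] at this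
  linarith

theorem FourPoint.min_le_gromovProduct (h : FourPoint X δ) (p x y z : X) :
    min (gromovProduct p x y) (gromovProduct p y z) - δ ≤ gromovProduct p x z := by
  have h1 := h x z p y
  have e1 := dist_comm x p
  have e2 := dist_comm z p
  have e3 := dist_comm z y
  unfold gromovProduct
  rcases le_total (dist x p + dist z y) (dist x y + dist z p) with h2 | h2
  · rw [max_eq_right h2] at h1
    have := min_le_left ((dist p x + dist p y - dist x y) / 2) ((dist p y + dist p z - dist y z) / 2)
    linarith
  · rw [max_eq_left h2] at h1
    have := min_le_right ((dist p x + dist p y - dist x y) / 2)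
      ((dist p y + dist p z - dist y z) / 2)
    linarith

theorem dist_sub_dist_le_gromovProduct (p x y : X) : dist p x - dist x y ≤ gromovProduct p x y := by
  have := dist_triangle p y x
  have := dist_comm x y
  unfold gromovProduct
  linarith

/-- Along a chain of `n ≤ 2 ^ k` steps the Gromov product drops by at most `k * δ`: subdivide the
chain dyadically. -/
theorem FourPoint.gromovProduct_chain (h : FourPoint X δ) (p : X) (c : ℕ → X) (B : ℝ) (k : ℕ) :
    ∀ i n : ℕ, 1 ≤ n → n ≤ 2 ^ k →
      (∀ j, i ≤ j → j < i + n → B ≤ gromovProduct p (c j) (c (j + 1))) →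
      B - k * δ ≤ gromovProduct p (c i) (c (i + n)) := by
  have hδ := h.nonneg p
  induction k with
  | zero =>
    intro i n h1 h2 hB
    obtain rfl : n = 1 := by simp at h2; omega
    simpa using hB i le_rfl (by omega)
  | succ k ih =>
    intro i n h1 h2 hB
    push_cast
    by_cases hn : n ≤ 2 ^ k
    · have := ih i n h1 hn hB
      linarith
    · push Not at hn
      have hk : 1 ≤ 2 ^ k := Nat.one_le_two_pow
      have a1 := ih i (2 ^ k) hk le_rfl fun j hj hj' => hB j hj (by omega)
      have a2 := ih (i + 2 ^ k) (n - 2 ^ k) (by omega) (by rw [pow_succ] at h2; omega)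
        fun j hj hj' => hB j (by omega) (by omega)
      rw [show i + 2 ^ k + (n - 2 ^ k) = i + n by omega] at a2
      have := h.min_le_gromovProduct p (c i) (c (i + 2 ^ k)) (c (i + n))
      have := le_min a1 a2
      linarith

theorem IsGeodesicSegment.dist_eq {γ : ℝ → X} {L : ℝ} {x y : X} (hγ : IsGeodesicSegment γ L x y) :
    dist x y = L := by
  have := hγ.isometric 0 ⟨le_rfl, hγ.nonneg⟩ L ⟨hγ.nonneg, le_rfl⟩
  rw [hγ.source, hγ.target, zero_sub, abs_neg, abs_of_nonneg hγ.nonneg] at this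
  exact this

theorem IsGeodesicSegment.dist_source {γ : ℝ → X} {L : ℝ} {x y : X}
    (hγ : IsGeodesicSegment γ L x y) {t : ℝ} (ht : t ∈ Set.Icc 0 L) : dist x (γ t) = t := by
  have := hγ.isometric 0 ⟨le_rfl, hγ.nonneg⟩ t ht
  rwa [hγ.source, zero_sub, abs_neg, abs_of_nonneg ht.1] at this

theorem IsGeodesicSegment.dist_target {γ : ℝ → X} {L : ℝ} {x y : X}
    (hγ : IsGeodesicSegment γ L x y) {t : ℝ} (ht : t ∈ Set.Icc 0 L) : dist (γ t) y = L - t := by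
  have := hγ.isometric t ht L ⟨hγ.nonneg, le_rfl⟩
  rwa [hγ.target, abs_sub_comm, abs_of_nonneg (by linarith [ht.2])] at this

/-- The Gromov product `(x | y)_p` bounds the distance from `p` to a geodesic from `x` to `y`; the
witness is the point at distance `(p | y)_x` from `x`. -/
theorem FourPoint.exists_dist_le_gromovProduct (h : FourPoint X δ) {γ : ℝ → X} {L : ℝ} {x y : X}
    (hγ : IsGeodesicSegment γ L x y) (p : X) :
    ∃ t ∈ Set.Icc 0 L, dist p (γ t) ≤ gromovProduct p x y + 2 * δ := by
  have hL := hγ.dist_eq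
  have ht : gromovProduct x p y ∈ Set.Icc 0 L := by
    have := dist_triangle p x y
    have := dist_triangle x y p
    have := dist_comm p x
    have := dist_comm p y
    unfold gromovProduct
    constructor <;> linarith
  refine ⟨_, ht, ?_⟩
  have h1 := hγ.dist_source ht
  have h2 := hγ.dist_target ht
  have h3 := h p (γ (gromovProduct x p y)) x y
  have h4 := dist_comm (γ (gromovProduct x p y)) x
  have h5 := dist_comm p x
  have key : gromovProduct x p y = (dist p x + dist x y - dist p y) / 2 := by
    unfold gromovProduct; rw [h5]
  have h6 : max (dist p x + dist (γ (gromovProduct x p y)) y)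
      (dist p y + dist (γ (gromovProduct x p y)) x) ≤ (dist p x + dist p y + L) / 2 :=
    max_le (by linarith) (by linarith)
  unfold gromovProduct at *
  linarith

/-- An isometry that moves the endpoints of a geodesic little moves each of its points little. -/
theorem FourPoint.dist_smul_le {G : Type*} [Group G] [MulAction G X] [IsIsometricSMul G X]
    (h : FourPoint X δ) {γ : ℝ → X} {L : ℝ} {x y : X} (hγ : IsGeodesicSegment γ L x y) (k : G)
    {D : ℝ} (hx : dist x (k • x) ≤ D) (hy : dist y (k • y) ≤ D) {t : ℝ} (ht : t ∈ Set.Icc 0 L) :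
    dist (γ t) (k • γ t) ≤ D + 2 * δ := by
  have h1 := h (γ t) (k • γ t) x y
  have h2 := hγ.dist_source ht
  have h3 := hγ.dist_target ht
  have h4 := hγ.dist_eq
  have h5 := dist_triangle (k • γ t) (k • y) y
  have h6 := dist_triangle (k • γ t) (k • x) x
  rw [dist_smul] at h5 h6
  have h7 := dist_comm (γ t) x
  have h8 := dist_comm (k • x) x
  have h9 := dist_comm (k • y) y
  have h10 : max (dist (γ t) x + dist (k • γ t) y) (dist (γ t) y + dist (k • γ t) x) ≤ L + D :=
    max_le (by linarith) (by linarith)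
  linarith

/-! ### Stability of quasi-geodesics -/

/-- The chain estimate along a quasi-geodesic that stays at distance `R` from `p`, cut into at most
`2 ^ k` pieces of parameter length at most `1`. -/
theorem FourPoint.gromovProduct_quasiGeodesic (h : FourPoint X δ) {f : ℝ → X} {K c : ℝ}
    (hK : 0 ≤ K) (hf : ∀ a b : ℝ, dist (f a) (f b) ≤ K * dist a b + c) {p : X} {s t R : ℝ}
    (hR : ∀ u ∈ Set.Icc s t, R ≤ dist p (f u)) {a b : ℝ} (ha : a ∈ Set.Icc s t)
    (hb : b ∈ Set.Icc s t) {k : ℕ} (hk : |b - a| + 2 ≤ 2 ^ k) :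
    R - (K + c) - k * δ ≤ gromovProduct p (f a) (f b) := by
  set n : ℕ := ⌈|b - a|⌉₊ + 1 with hn
  have hn1 : |b - a| ≤ n := by
    rw [hn]; push_cast; linarith [Nat.le_ceil |b - a|]
  have hn2 : (n : ℝ) ≤ 2 ^ k := by
    rw [hn]; push_cast; linarith [Nat.ceil_lt_add_one (abs_nonneg (b - a))]
  have hn0 : (0 : ℝ) < n := by rw [hn]; positivity
  have key := h.gromovProduct_chain p (fun i => f (a + i / n * (b - a))) (R - (K + c)) k 0 n
    (by omega) (by exact_mod_cast hn2) fun j _ hj => by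
      refine le_trans ?_ (dist_sub_dist_le_gromovProduct _ _ _)
      have h1 : a + (j : ℝ) / n * (b - a) ∈ Set.Icc s t := by
        have hj0 : (0 : ℝ) ≤ (j : ℝ) / n := by positivity
        have hj1 : (j : ℝ) / n ≤ 1 := by
          rw [div_le_one hn0]; exact_mod_cast (by omega : j ≤ n)
        have := (convex_Icc s t) ha hb (by linarith : (0 : ℝ) ≤ 1 - (j : ℝ) / n) hj0 (by ring)
        convert this using 1
        simp only [smul_eq_mul]; ring
      have h2 := hR _ h1
      have h3 := hf (a + (j : ℝ) / n * (b - a)) (a + ((j + 1 : ℕ) : ℝ) / n * (b - a))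
      have h4 : dist (a + (j : ℝ) / n * (b - a)) (a + ((j + 1 : ℕ) : ℝ) / n * (b - a)) ≤ 1 := by
        rw [Real.dist_eq, show a + (j : ℝ) / n * (b - a) - (a + ((j + 1 : ℕ) : ℝ) / n * (b - a))
          = -((b - a) / n) by push_cast; field_simp; ring, abs_neg, abs_div, abs_of_pos hn0]
        exact (div_le_one hn0).2 hn1
      have h5 := mul_le_mul_of_nonneg_left h4 hK
      linarith
  have e : a + (n : ℝ) / n * (b - a) = b := by field_simp; ring
  simpa [e] using key

/-- A quantity which grows at most like the logarithm of an affine function of itself is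
bounded. -/
theorem exists_bound_of_le_log (A B E δ : ℝ) (hB : 0 ≤ B) (hδ : 0 ≤ δ) :
    ∃ M : ℝ, ∀ D : ℝ, (∀ k : ℕ, B * D + E ≤ 2 ^ k → D ≤ A + k * δ) → D ≤ M := by
  have ht : Filter.Tendsto (fun k : ℕ => (B * (A + (k + 1 : ℝ) * δ) + E) / 2 ^ k) Filter.atTop
      (nhds 0) := by
    have h1 := tendsto_pow_const_div_const_pow_of_one_lt 1 (one_lt_two : (1 : ℝ) < 2)
    have h0 := tendsto_pow_const_div_const_pow_of_one_lt 0 (one_lt_two : (1 : ℝ) < 2)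
    have := (h1.const_mul (B * δ)).add (h0.const_mul (B * (A + δ) + E))
    simp only [mul_zero, add_zero] at this
    refine this.congr fun k => ?_
    field_simp
    ring
  obtain ⟨k₀, hk₀⟩ := Filter.eventually_atTop.1 (ht.eventually (gt_mem_nhds one_pos))
  refine ⟨A + (k₀ + 1) * δ, fun D hD => ?_⟩
  have hex : ∃ k : ℕ, B * D + E ≤ 2 ^ k := by
    obtain ⟨k, hk⟩ := pow_unbounded_of_one_lt (B * D + E) (one_lt_two : (1 : ℝ) < 2)
    exact ⟨k, hk.le⟩
  classical
  -- the least admissible `k` is at most `k₀`, since `2 ^ (k - 1)` would otherwise be too large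
  have hk := hD _ (Nat.find_spec hex)
  by_cases hle : Nat.find hex ≤ k₀
  · have : (Nat.find hex : ℝ) ≤ k₀ := by exact_mod_cast hle
    nlinarith
  · push Not at hle
    obtain ⟨m, hm⟩ : ∃ m, Nat.find hex = m + 1 := ⟨Nat.find hex - 1, by omega⟩
    have h1 := Nat.find_min hex (m := m) (by omega)
    have h2 := hk₀ m (by omega)
    rw [div_lt_one (by positivity)] at h2
    rw [hm] at hk
    push_cast at hk
    have := mul_le_mul_of_nonneg_left hk hB
    linarith

/-- The half of stability of quasi-geodesics that is needed: a geodesic between two points of a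
quasi-geodesic stays close to the quasi-geodesic. At a point of the geodesic farthest from the
quasi-geodesic, at distance about `D`, the detour through the quasi-geodesic has length linear in
`D`, whereas by `FourPoint.gromovProduct_chain` it comes within logarithmic distance. -/
theorem FourPoint.exists_dist_quasiGeodesic_le (h : FourPoint X δ) {f : ℝ → X}
    (hf : IsQuasiIsometricEmbedding f) :
    ∃ M : ℝ, ∀ (s t : ℝ), s ≤ t → ∀ (γ : ℝ → X) (L : ℝ), IsGeodesicSegment γ L (f s) (f t) →
      ∀ u ∈ Set.Icc 0 L, ∃ v ∈ Set.Icc s t, dist (γ u) (f v) ≤ M := by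
  obtain ⟨K, c, hK, hc, hf⟩ := hf
  have hδ := h.nonneg (f 0)
  obtain ⟨M, hM⟩ := exists_bound_of_le_log (1 + K + c + 2 * δ) (6 * K) (K * (6 + c) + 2) δ
    (by positivity) hδ
  refine ⟨M + 1, fun s t hst γ L hγ => ?_⟩
  set S := f '' Set.Icc s t
  have hsS : f s ∈ S := ⟨s, ⟨le_rfl, hst⟩, rfl⟩
  set T := (fun u => Metric.infDist (γ u) S) '' Set.Icc 0 L
  have hbdd : BddAbove T := by
    refine ⟨L, ?_⟩
    rintro _ ⟨u, hu, rfl⟩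
    have := Metric.infDist_le_dist_of_mem (x := γ u) hsS
    rw [dist_comm, hγ.dist_source hu] at this
    exact this.trans hu.2
  have hTne : T.Nonempty := ⟨_, 0, ⟨le_rfl, hγ.nonneg⟩, rfl⟩
  set D := sSup T
  have hle : ∀ u ∈ Set.Icc 0 L, Metric.infDist (γ u) S ≤ D := fun u hu => le_csSup hbdd ⟨u, hu, rfl⟩
  have hD0 : 0 ≤ D := Metric.infDist_nonneg.trans (hle 0 ⟨le_rfl, hγ.nonneg⟩)
  have hnear : ∀ u ∈ Set.Icc 0 L, ∃ v ∈ Set.Icc s t, dist (γ u) (f v) ≤ D + 1 := by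
    intro u hu
    obtain ⟨_, ⟨v, hv, rfl⟩, h1⟩ := (Metric.infDist_lt_iff ⟨_, hsS⟩).1
      ((hle u hu).trans_lt (lt_add_one D))
    exact ⟨v, hv, h1.le⟩
  suffices D ≤ M by
    intro u hu
    obtain ⟨v, hv, h1⟩ := hnear u hu
    exact ⟨v, hv, h1.trans (by linarith)⟩
  refine hM D fun k hk => ?_
  obtain ⟨_, ⟨u₀, hu₀, rfl⟩, hu₀D⟩ := exists_lt_of_lt_csSup hTne (sub_one_lt D)
  have hfar : ∀ v ∈ Set.Icc s t, D - 1 ≤ dist (γ u₀) (f v) := fun v hv =>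
    hu₀D.le.trans (Metric.infDist_le_dist_of_mem ⟨v, hv, rfl⟩)
  -- The detour leaves the geodesic at distance `2 (D + 1)` on either side of the farthest point,
  -- or at the endpoint of the geodesic if that comes earlier.
  obtain ⟨u₁, hu₁, a, ha, h1, h1', h1''⟩ : ∃ u₁ ∈ Set.Icc 0 u₀, ∃ a ∈ Set.Icc s t,
      dist (γ u₁) (f a) ≤ D + 1 ∧ u₀ - u₁ ≤ 2 * (D + 1) ∧
      D - 1 ≤ gromovProduct (γ u₀) (γ u₁) (f a) := by
    by_cases hc1 : u₀ ≤ 2 * (D + 1)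
    · refine ⟨0, ⟨le_rfl, hu₀.1⟩, s, ⟨le_rfl, hst⟩, ?_, by linarith, ?_⟩
      · rw [hγ.source, dist_self]; linarith
      · rw [hγ.source]
        refine le_trans ?_ (dist_sub_dist_le_gromovProduct _ _ _)
        rw [dist_self, sub_zero]
        exact hfar s ⟨le_rfl, hst⟩
    · push Not at hc1
      have hm : u₀ - 2 * (D + 1) ∈ Set.Icc 0 L := ⟨by linarith, by linarith [hu₀.2]⟩
      obtain ⟨a, ha, h1⟩ := hnear _ hm
      refine ⟨_, ⟨hm.1, by linarith⟩, a, ha, h1, by linarith, ?_⟩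
      refine le_trans ?_ (dist_sub_dist_le_gromovProduct _ _ _)
      rw [hγ.isometric _ hu₀ _ hm, sub_sub_cancel, abs_of_nonneg (by positivity)]
      linarith
  obtain ⟨u₂, hu₂, b, hb, h2, h2', h2''⟩ : ∃ u₂ ∈ Set.Icc u₀ L, ∃ b ∈ Set.Icc s t,
      dist (γ u₂) (f b) ≤ D + 1 ∧ u₂ - u₀ ≤ 2 * (D + 1) ∧
      D - 1 ≤ gromovProduct (γ u₀) (f b) (γ u₂) := by
    have hcomm : ∀ x y : X, gromovProduct (γ u₀) x y = gromovProduct (γ u₀) y x := fun x y => by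
      unfold gromovProduct; rw [dist_comm x y]; ring
    by_cases hc1 : L ≤ u₀ + 2 * (D + 1)
    · refine ⟨L, ⟨hu₀.2, le_rfl⟩, t, ⟨hst, le_rfl⟩, ?_, by linarith, ?_⟩
      · rw [hγ.target, dist_self]; linarith
      · rw [hγ.target]
        refine le_trans ?_ (dist_sub_dist_le_gromovProduct _ _ _)
        rw [dist_self, sub_zero]
        exact hfar t ⟨hst, le_rfl⟩
    · push Not at hc1
      have hm : u₀ + 2 * (D + 1) ∈ Set.Icc 0 L := ⟨by linarith [hu₀.1], hc1.le⟩
      obtain ⟨b, hb, h1⟩ := hnear _ hm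
      refine ⟨_, ⟨by linarith, hm.2⟩, b, hb, h1, by linarith, ?_⟩
      rw [hcomm]
      refine le_trans ?_ (dist_sub_dist_le_gromovProduct _ _ _)
      rw [hγ.isometric _ hu₀ _ hm, show u₀ - (u₀ + 2 * (D + 1)) = -(2 * (D + 1)) by ring, abs_neg,
        abs_of_nonneg (by positivity)]
      linarith
  have hu₁' : u₁ ∈ Set.Icc 0 L := ⟨hu₁.1, hu₁.2.trans hu₀.2⟩
  have hu₂' : u₂ ∈ Set.Icc 0 L := ⟨hu₀.1.trans hu₂.1, hu₂.2⟩
  have e1 : dist (γ u₀) (γ u₁) = u₀ - u₁ := by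
    rw [hγ.isometric _ hu₀ _ hu₁', abs_of_nonneg (by linarith [hu₁.2])]
  have e2 : dist (γ u₀) (γ u₂) = u₂ - u₀ := by
    rw [hγ.isometric _ hu₀ _ hu₂', abs_sub_comm, abs_of_nonneg (by linarith [hu₂.1])]
  have e3 : dist (γ u₁) (γ u₂) = u₂ - u₁ := by
    rw [hγ.isometric _ hu₁' _ hu₂', abs_sub_comm, abs_of_nonneg (by linarith [hu₁.2, hu₂.1])]
  have hzero : gromovProduct (γ u₀) (γ u₁) (γ u₂) = 0 := by
    unfold gromovProduct; rw [e1, e2, e3]; ring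
  have hab : |b - a| ≤ K * (6 * (D + 1) + c) := by
    have h3 := (hf a b).1
    have h4 := dist_triangle4 (f a) (γ u₁) (γ u₂) (f b)
    rw [dist_comm (f a) (γ u₁)] at h4
    have h5 : dist a b / K ≤ 6 * (D + 1) + c := by linarith
    rw [div_le_iff₀ (by positivity), dist_comm, Real.dist_eq] at h5
    linarith
  have hmid := h.gromovProduct_quasiGeodesic (by positivity) (fun a b => (hf a b).2) hfar ha hb
    (k := k) (by linarith)
  have h6 := h.min_le_gromovProduct (γ u₀) (γ u₁) (f a) (γ u₂)
  have h7 := h.min_le_gromovProduct (γ u₀) (f a) (f b) (γ u₂)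
  have hk0 : 0 ≤ (k : ℝ) * δ := by positivity
  have h8 : D - 1 - (K + c) - k * δ ≤
      min (gromovProduct (γ u₀) (f a) (f b)) (gromovProduct (γ u₀) (f b) (γ u₂)) :=
    le_min hmid (by linarith)
  have h9 : D - 1 - (K + c) - k * δ - δ ≤
      min (gromovProduct (γ u₀) (γ u₁) (f a)) (gromovProduct (γ u₀) (f a) (γ u₂)) :=
    le_min (by linarith) (by linarith)
  linarith

/-- The floor extension of a quasi-isometric embedding of `ℤ` is one of `ℝ`. -/
theorem IsQuasiIsometricEmbedding.comp_floor {f : ℤ → X} (hf : IsQuasiIsometricEmbedding f) :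
    IsQuasiIsometricEmbedding (fun t : ℝ => f ⌊t⌋) := by
  obtain ⟨K, c, hK, hc, hf⟩ := hf
  refine ⟨K, c + K, hK, by positivity, fun a b => ?_⟩
  have hK0 : 0 < K := by positivity
  obtain ⟨h1, h2⟩ := hf ⌊a⌋ ⌊b⌋
  have h3 : |dist a b - dist ⌊a⌋ ⌊b⌋| ≤ 1 := by
    rw [Int.dist_eq, Real.dist_eq]
    refine (abs_abs_sub_abs_le_abs_sub _ _).trans ?_
    have := Int.floor_le a
    have := Int.lt_floor_add_one a
    have := Int.floor_le b
    have := Int.lt_floor_add_one b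
    rw [abs_le]; constructor <;> linarith
  rw [abs_le] at h3
  constructor
  · have : dist a b / K ≤ (dist ⌊a⌋ ⌊b⌋ + 1) / K := by gcongr; linarith
    have h4 : 1 / K ≤ 1 := (div_le_one hK0).2 hK
    rw [add_div] at this
    change _ ≤ dist (f ⌊a⌋) (f ⌊b⌋)
    linarith
  · have : K * dist ⌊a⌋ ⌊b⌋ ≤ K * (dist a b + 1) := by gcongr; linarith
    change dist (f ⌊a⌋) (f ⌊b⌋) ≤ _
    linarith

/-- The other half of stability, for a quasi-isometrically embedded copy of `ℤ`: its points between
`f 0` and `f n` are close to each geodesic between these two points. As one moves along the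
geodesic, the parameter of a nearby point `f k` jumps a bounded amount at a time, so it comes
close to every `m` between `0` and `n`. -/
theorem FourPoint.exists_dist_geodesic_le (h : FourPoint X δ) {f : ℤ → X}
    (hf : IsQuasiIsometricEmbedding f) :
    ∃ F : ℝ, ∀ (m n : ℕ), m ≤ n → ∀ (γ : ℝ → X) (L : ℝ), IsGeodesicSegment γ L (f 0) (f n) →
      ∃ t ∈ Set.Icc 0 L, dist (f m) (γ t) ≤ F := by
  obtain ⟨M₀, hM₀⟩ := h.exists_dist_quasiGeodesic_le hf.comp_floor
  obtain ⟨K, c, hK, hc, hf⟩ := hf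
  have hK0 : 0 < K := by positivity
  set M := max M₀ 0
  refine ⟨K * (K * (2 * M + 1 + c)) + c + M, fun m n hmn γ L hγ => ?_⟩
  have hclose : ∀ u ∈ Set.Icc 0 L, ∃ k : ℤ, dist (γ u) (f k) ≤ M := by
    intro u hu
    obtain ⟨v, _, h1⟩ := hM₀ 0 n (by positivity) γ L (by simpa using hγ) u hu
    exact ⟨⌊v⌋, h1.trans (le_max_left _ _)⟩
  set T := {u ∈ Set.Icc 0 L | ∃ k : ℤ, k ≤ m ∧ dist (γ u) (f k) ≤ M}
  have h0T : (0 : ℝ) ∈ T := by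
    refine ⟨⟨le_rfl, hγ.nonneg⟩, 0, by positivity, ?_⟩
    rw [hγ.source, dist_self]
    exact le_max_right _ _
  have hbdd : BddAbove T := ⟨L, fun u hu => hu.1.2⟩
  obtain ⟨u, ⟨hu, k, hkm, hk⟩, huT⟩ := exists_lt_of_lt_csSup ⟨_, h0T⟩ (sub_one_lt (sSup T))
  obtain ⟨u', hu', huu', k', hk'm, hk'⟩ : ∃ u' ∈ Set.Icc 0 L, |u - u'| ≤ 1 ∧
      ∃ k' : ℤ, m ≤ k' ∧ dist (γ u') (f k') ≤ M := by
    by_cases hc1 : u + 1 ≤ L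
    · have hm : u + 1 ∈ Set.Icc 0 L := ⟨by linarith [hu.1], hc1⟩
      obtain ⟨k', hk'⟩ := hclose _ hm
      refine ⟨_, hm, by simp, k', ?_, hk'⟩
      by_contra! hlt
      have : u + 1 ≤ sSup T := le_csSup hbdd ⟨hm, k', hlt.le, hk'⟩
      linarith
    · push Not at hc1
      refine ⟨L, ⟨hγ.nonneg, le_rfl⟩, ?_, n, by exact_mod_cast hmn, ?_⟩
      · rw [abs_le]; constructor <;> linarith [hu.2]
      · rw [hγ.target, dist_self]
        exact le_max_right _ _
  refine ⟨u, hu, ?_⟩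
  have h1 := (hf k k').1
  have h2 := dist_triangle4 (f k) (γ u) (γ u') (f k')
  rw [dist_comm (f k) (γ u), hγ.isometric _ hu _ hu'] at h2
  have h3 : dist k k' ≤ K * (2 * M + 1 + c) := by
    have : dist k k' / K ≤ 2 * M + 1 + c := by linarith
    rwa [div_le_iff₀ hK0, mul_comm] at this
  have h4 : dist (m : ℤ) k ≤ dist k k' := by
    rw [Int.dist_eq, Int.dist_eq, abs_of_nonneg (by push_cast; exact_mod_cast sub_nonneg.2 hkm),
      abs_sub_comm, abs_of_nonneg (by exact_mod_cast sub_nonneg.2 (hkm.trans hk'm))]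
    have : ((m : ℤ) : ℝ) ≤ k' := by exact_mod_cast hk'm
    linarith
  have h5 := (hf m k).2
  have h6 := dist_triangle (f m) (f k) (γ u)
  rw [dist_comm (f k) (γ u)] at h6
  have h7 := mul_le_mul_of_nonneg_left (h4.trans h3) hK0.le
  linarith

/-! ### Projection to a quasi-geodesic -/

/-- The projection to a quasi-geodesic is strongly contracting: if `x` and `y` have projections far
apart then going from `x` to `y` through their projections is nearly optimal. -/
theorem FourPoint.exists_contracting (h : FourPoint X δ) (hgeod : IsGeodesicSpace X) {α : ℝ → X}
    (hα : IsQuasiIsometricEmbedding α) {π : X → X}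
    (hπ : IsNearestPointProjection (Set.range α) π) :
    ∃ E : ℝ, 0 ≤ E ∧ ∀ x y : X, E < dist (π x) (π y) →
      dist x (π x) + dist (π x) (π y) + dist (π y) y ≤ dist x y + E := by
  obtain ⟨M, hM⟩ := h.exists_dist_quasiGeodesic_le hα
  obtain ⟨c, hc, hπ⟩ := hπ
  have hδ := h.nonneg (α 0)
  -- A geodesic between two points of `α` is near `α`, hence comes no closer to `x` than `π x`.
  have key : ∀ x : X, ∀ q ∈ Set.range α,
      dist x (π x) + dist (π x) q ≤ dist x q + 2 * (c + M + 2 * δ) := by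
    intro x q hq
    have hproj : ∀ (s t : ℝ), s ≤ t →
        dist x (π x) ≤ gromovProduct x (α s) (α t) + 2 * δ + M + c := by
      intro s t hst
      obtain ⟨γ, L, hγ⟩ := hgeod (α s) (α t)
      obtain ⟨u, hu, h1⟩ := h.exists_dist_le_gromovProduct hγ x
      obtain ⟨v, _, h2⟩ := hM s t hst γ L hγ u hu
      have h3 := Metric.infDist_le_dist_of_mem (x := x) (Set.mem_range_self (f := α) v)
      have h4 := dist_triangle x (γ u) (α v)
      have h5 := (hπ x).2
      linarith
    obtain ⟨s, hs⟩ := (hπ x).1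
    obtain ⟨t, rfl⟩ := hq
    have hcomm := dist_comm (α s) (α t)
    rw [← hs] at hproj ⊢
    rcases le_total s t with hst | hst
    · have := hproj s t hst
      unfold gromovProduct at this
      linarith
    · have := hproj t s hst
      unfold gromovProduct at this
      linarith
  have hM0 : 0 ≤ c + M + 2 * δ := by
    have := key (α 0) _ (hπ (α 0)).1
    rw [dist_self] at this
    linarith
  refine ⟨4 * (c + M + 2 * δ) + 2 * δ, by positivity, fun x y hxy => ?_⟩
  have h1 := key x (π y) (hπ y).1
  have h2 := key y (π x) (hπ x).1
  have h3 := h x (π y) y (π x)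
  have e1 := dist_comm (π y) y
  have e2 := dist_comm (π y) (π x)
  rcases le_total (dist x y + dist (π y) (π x)) (dist x (π x) + dist (π y) y) with h4 | h4
  · rw [max_eq_right h4] at h3
    linarith
  · rw [max_eq_left h4] at h3
    linarith

end Hyperbolic

/-! ### The electrification -/

namespace Electrification

section

variable {G X : Type*} [Group G] [MetricSpace X] [MulAction G X]

theorem dist_base_le (Y : EquivariantFamily G X) (x y : X) :
    dist (base x : Electrification Y.sets) (base y) ≤ dist x y :=
  csInf_le (bddBelow_isPath _ _) (isPath_base x y)

/-- A nonnegative function on `X` which is `1`-Lipschitz and varies by at most `B` on each set of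
the family is Lipschitz for the metric of the electrification: give the cone vertex of `A` the
infimum over `A`, and interpolate linearly along the edges. -/
theorem sub_le_mul_dist_base (Y : EquivariantFamily G X) (φ : X → ℝ) (hφ0 : ∀ x, 0 ≤ φ x)
    (hφ : ∀ x y, φ y ≤ φ x + dist x y) (B : ℝ) (hB : 1 ≤ B)
    (hosc : ∀ A ∈ Y.sets, ∀ a ∈ A, ∀ b ∈ A, φ b ≤ φ a + B) (x y : X) :
    φ y - φ x ≤ 2 * B * dist (base x : Electrification Y.sets) (base y) := by
  have hB0 : 0 < 2 * B := by positivity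
  let f : Electrification Y.sets → ℝ
    | base z => φ z / (2 * B)
    | cone A _ => sInf (φ '' A) / (2 * B)
    | edge A _ a _ t _ => ((1 - 2 * t) * φ a + 2 * t * sInf (φ '' A)) / (2 * B)
  have hedge : ∀ (A : Set X) (hA : A ∈ Y.sets) (a : X) (ha : a ∈ A), ∀ t ∈ Set.Icc (0 : ℝ) (1 / 2),
      f (edgePoint A hA a ha t) = ((1 - 2 * t) * φ a + 2 * t * sInf (φ '' A)) / (2 * B) := by
    intro A hA a ha t ht
    rcases edgePoint_cases A hA a ha t ht with ⟨rfl, e⟩ | ⟨rfl, e⟩ | ⟨_, e⟩ <;> rw [e] <;>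
      simp [f]
  have hle : ∀ l : ℝ, IsPath (base x : Electrification Y.sets) (base y) l →
      (φ y - φ x) / (2 * B) ≤ l := by
    intro l hl
    have := hl.le_of_lipschitz f (fun z w => ?_) (fun A hA a ha s hs t ht => ?_)
    · simp only [f] at this
      rw [sub_div]
      linarith
    · simp only [f]
      have h1 := hφ z w
      have h2 : dist z w / (2 * B) ≤ dist z w := div_le_self dist_nonneg (by linarith)
      have h3 : φ w / (2 * B) ≤ (φ z + dist z w) / (2 * B) := by gcongr
      rw [add_div] at h3
      linarith
    · rw [hedge A hA a ha t ht, hedge A hA a ha s hs, div_add' _ _ _ hB0.ne']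
      refine (div_le_div_iff_of_pos_right hB0).2 ?_
      have hbdd : BddBelow (φ '' A) := ⟨0, by rintro _ ⟨z, _, rfl⟩; exact hφ0 z⟩
      have h1 : sInf (φ '' A) ≤ φ a := csInf_le hbdd ⟨a, ha, rfl⟩
      have h2 : φ a - B ≤ sInf (φ '' A) := by
        refine le_csInf ⟨_, a, ha, rfl⟩ ?_
        rintro _ ⟨b, hb, rfl⟩
        linarith [hosc A hA b hb a ha]
      have h3 : (s - t) * (φ a - sInf (φ '' A)) ≤ |s - t| * B :=
        (mul_le_mul_of_nonneg_right (le_abs_self _) (by linarith)).trans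
          (mul_le_mul_of_nonneg_left (by linarith) (abs_nonneg _))
      linarith
  have : (φ y - φ x) / (2 * B) ≤ dist (base x : Electrification Y.sets) (base y) :=
    le_csInf (exists_isPath Y.nonempty _ _) hle
  rwa [div_le_iff₀ hB0, mul_comm] at this

/-- A map `π` which is coarsely `1`-Lipschitz on `X` and maps the sets of the family to sets of
bounded diameter is coarsely Lipschitz for the metric of the electrification. Replacing
`d(π x, π ·)` by the function `y ↦ inf_z (d(π x, π z) + d(z, y))`, which differs from it by a bounded
amount, gives a function which is `1`-Lipschitz without an additive error. -/
theorem dist_map_le_mul_dist_base (Y : EquivariantFamily G X) (π : X → X) {E C : ℝ} (hE : 0 ≤ E)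
    (hC : 0 ≤ C) (hπ : ∀ x y, dist (π x) (π y) ≤ dist x y + E)
    (hπY : ∀ A ∈ Y.sets, ∀ a ∈ A, ∀ b ∈ A, dist (π a) (π b) ≤ C) (x y : X) :
    dist (π x) (π y) ≤
      2 * (C + E + 1) * dist (base x : Electrification Y.sets) (base y) + E := by
  have : Nonempty X := ⟨x⟩
  let φ : X → ℝ := fun w => ⨅ z, (dist (π x) (π z) + dist z w)
  have hbdd : ∀ w, BddBelow (Set.range fun z => dist (π x) (π z) + dist z w) := fun w =>
    ⟨0, by rintro _ ⟨z, rfl⟩; positivity⟩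
  have hup : ∀ w, φ w ≤ dist (π x) (π w) := fun w => by simpa using ciInf_le (hbdd w) w
  have hlow : ∀ w, dist (π x) (π w) - E ≤ φ w := fun w => le_ciInf fun z => by
    have := hπ z w
    have := dist_triangle (π x) (π z) (π w)
    linarith
  have key := sub_le_mul_dist_base Y φ (fun w => le_ciInf fun z => by positivity) (fun z w => ?_)
    (C + E + 1) (by linarith) (fun A hA a ha b hb => ?_) x y
  · have h1 := hup x
    rw [dist_self] at h1
    have h2 := hlow y
    linarith
  · rw [← sub_le_iff_le_add]
    refine le_ciInf fun v => ?_
    have h1 : φ w ≤ dist (π x) (π v) + dist v w := ciInf_le (hbdd w) v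
    have := dist_triangle v z w
    linarith
  · have := hup b
    have := hlow a
    have := hπY A hA a ha b hb
    have := dist_triangle (π x) (π a) (π b)
    linarith

end

end Electrification

/-! ### Loxodromic and WPD elements -/

section

variable {G Z : Type*} [Group G] [PseudoMetricSpace Z] [MulAction G Z] [IsIsometricSMul G Z]

/-- Loxodromicity need only be tested at one point. -/
theorem IsLoxodromic.of_point {g : G} (z₀ : Z)
    (h : IsQuasiIsometricEmbedding (fun n : ℤ => g ^ n • z₀)) : IsLoxodromic Z g := by
  intro z
  obtain ⟨K, c, hK, hc, h⟩ := h
  refine ⟨K, c + 2 * dist z z₀, hK, by positivity, fun m n => ?_⟩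
  obtain ⟨h1, h2⟩ := h m n
  have h3 := dist_triangle4 (g ^ m • z) (g ^ m • z₀) (g ^ n • z₀) (g ^ n • z)
  have h4 := dist_triangle4 (g ^ m • z₀) (g ^ m • z) (g ^ n • z) (g ^ n • z₀)
  simp only [dist_smul] at h3 h4
  rw [dist_comm z₀ z] at h3 h4
  constructor
  · change _ ≤ dist (g ^ m • z) (g ^ n • z)
    linarith
  · change dist (g ^ m • z) (g ^ n • z) ≤ _
    linarith

/-- The WPD condition need only be tested at one point. -/
theorem IsWPD.of_point {g : G} (z₀ : Z) (hg : IsLoxodromic Z g)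
    (h : ∀ r : ℝ, 0 < r → ∃ N : ℕ,
      {h : G | dist z₀ (h • z₀) < r ∧ dist (g ^ N • z₀) (h • g ^ N • z₀) < r}.Finite) :
    IsWPD Z g := by
  refine ⟨hg, fun r hr z => ?_⟩
  obtain ⟨N, hN⟩ := h (r + 2 * dist z z₀) (by positivity)
  refine ⟨N, hN.subset ?_⟩
  rintro k ⟨h1, h2⟩
  have h3 := dist_triangle4 z₀ z (k • z) (k • z₀)
  have h4 := dist_triangle4 (g ^ N • z₀) (g ^ N • z) (k • g ^ N • z) (k • g ^ N • z₀)
  simp only [dist_smul] at h3 h4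
  rw [dist_comm z₀ z] at h3 h4
  exact ⟨by linarith, by linarith⟩

end

theorem IsQuasiAxis.zpow_smul_mem {G X : Type*} [Group G] [PseudoMetricSpace X] [MulAction G X]
    {g : G} {α : ℝ → X} (hα : IsQuasiAxis g α) (n : ℤ) {x : X} (hx : x ∈ Set.range α) :
    g ^ n • x ∈ Set.range α := by
  have h : g ∈ MulAction.stabilizer G (Set.range α) := hα.2
  have hn : g ^ n • Set.range α = Set.range α := zpow_mem h n
  exact hn ▸ Set.smul_mem_smul_set hx

/-- In a hyperbolic space the elements which move `x` and `gⁿ x` by at most `D` are, uniformly in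
`n ≥ m`, elements which move `gᵐ x` by a bounded amount. -/
theorem FourPoint.exists_dist_zpow_smul_le {G X : Type*} [Group G] [PseudoMetricSpace X]
    [MulAction G X] [IsIsometricSMul G X] {δ : ℝ} (h : FourPoint X δ) (hgeod : IsGeodesicSpace X)
    {g : G} (hg : IsLoxodromic X g) (x : X) (D : ℝ) :
    ∃ R : ℝ, ∀ (m n : ℕ), m ≤ n → ∀ k : G, dist x (k • x) ≤ D →
      dist (g ^ n • x) (k • g ^ n • x) ≤ D → dist (g ^ m • x) (k • g ^ m • x) ≤ R := by
  obtain ⟨F, hF⟩ := h.exists_dist_geodesic_le (hg x)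
  refine ⟨2 * F + D + 2 * δ, fun m n hmn k h1 h2 => ?_⟩
  obtain ⟨γ, L, hγ⟩ := hgeod x (g ^ n • x)
  obtain ⟨t, ht, h3⟩ := hF m n hmn γ L (by simpa using hγ)
  rw [zpow_natCast] at h3
  have h4 := h.dist_smul_le hγ k h1 h2 ht
  have h5 := dist_triangle4 (g ^ m • x) (γ t) (k • γ t) (k • g ^ m • x)
  rw [dist_smul, dist_comm (γ t) (g ^ m • x)] at h5
  linarith

theorem mainTheorem3 {G X : Type*} [Group G] [MetricSpace X] [MulAction G X] [IsIsometricSMul G X]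
    (hgeod : IsGeodesicSpace X) (hhyp : IsGromovHyperbolic X)
    (Y : EquivariantFamily G X) (hY : UniformlyQuasiconvex Y.sets)
    (g : G) (hg : IsWPD X g)
    (α : ℝ → X) (hα : IsQuasiAxis g α)
    (π : X → X) (hπ : IsNearestPointProjection (Set.range α) π)
    (C : NNReal) (hC : ∀ A ∈ Y.sets, Metric.ediam (π '' A) < C) :
    IsWPD (Electrification Y.sets) g := by
  obtain ⟨δ, hδ : FourPoint X δ⟩ := hhyp
  have hδ0 := hδ.nonneg (α 0)
  obtain ⟨E, hE0, hE⟩ := hδ.exists_contracting hgeod hα.1 hπ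
  obtain ⟨M, hM⟩ := hδ.exists_dist_quasiGeodesic_le hα.1
  obtain ⟨c, hc, hπ⟩ := hπ
  have hπ_self : ∀ p ∈ Set.range α, dist p (π p) ≤ c := fun p hp => by
    simpa [Metric.infDist_zero_of_mem hp] using (hπ p).2
  have hπ_lip : ∀ x y, dist (π x) (π y) ≤ dist x y + E := fun x y => by
    rcases le_or_gt (dist (π x) (π y)) E with h | h
    · linarith [dist_nonneg (x := x) (y := y)]
    · linarith [hE x y h, dist_nonneg (x := x) (y := π x), dist_nonneg (x := π y) (y := y)]
  have hπY : ∀ A ∈ Y.sets, ∀ a ∈ A, ∀ b ∈ A, dist (π a) (π b) ≤ C := fun A hA a ha b hb => by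
    have := (Metric.edist_le_ediam_of_mem (Set.mem_image_of_mem π ha)
      (Set.mem_image_of_mem π hb)).trans (hC A hA).le
    rwa [edist_nndist, ENNReal.coe_le_coe] at this
  set Λ : ℝ := 2 * (C + E + 1) with hΛ
  have hΛ1 : 1 ≤ Λ := by
    have : (0 : ℝ) ≤ C := C.2
    rw [hΛ]; linarith
  have hΛ0 : 0 < Λ := by positivity
  have hproj : ∀ x y : X, dist (π x) (π y) ≤
      Λ * dist (Electrification.base x : Electrification Y.sets) (.base y) + E :=
    Electrification.dist_map_le_mul_dist_base Y π hE0 C.2 hπ_lip hπY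
  -- The axis is still quasi-isometrically embedded in the electrification.
  have hemb : ∀ p ∈ Set.range α, ∀ q ∈ Set.range α, dist p q ≤
      Λ * dist (Electrification.base p : Electrification Y.sets) (.base q) + (E + 2 * c) := by
    intro p hp q hq
    have h1 := dist_triangle4 p (π p) (π q) q
    have h2 := hπ_self p hp
    have h3 := hπ_self q hq
    rw [dist_comm] at h3
    linarith [hproj p q]
  set x₀ := α 0
  have hx₀ : ∀ n : ℤ, g ^ n • x₀ ∈ Set.range α := fun n => hα.zpow_smul_mem n ⟨0, rfl⟩
  have hx₀' : ∀ n : ℕ, g ^ n • x₀ ∈ Set.range α := fun n => by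
    simpa only [zpow_natCast] using hx₀ n
  let z₀ : Electrification Y.sets := .base x₀
  obtain ⟨K, b, hK, hb, hlox⟩ := hg.1 x₀
  have hK0 : 0 < K := by positivity
  refine IsWPD.of_point z₀ (IsLoxodromic.of_point z₀
    ⟨K * Λ, b + (E + 2 * c), ?_, by positivity, fun m n => ⟨?_, ?_⟩⟩) fun r hr => ?_
  · nlinarith
  · have h1 := (hlox m n).1
    have h2 := hemb _ (hx₀ m) _ (hx₀ n)
    change _ ≤ dist (Electrification.base (g ^ m • x₀) : Electrification Y.sets)
      (.base (g ^ n • x₀))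
    have h3 : dist m n / K ≤ Λ * dist (Electrification.base (g ^ m • x₀) : Electrification Y.sets)
      (.base (g ^ n • x₀)) + (b + (E + 2 * c)) := by linarith
    have h4 : (b + (E + 2 * c)) / Λ ≤ b + (E + 2 * c) := div_le_self (by positivity) hΛ1
    rw [← div_le_div_iff_of_pos_right hΛ0, add_div, mul_div_cancel_left₀ _ hΛ0.ne', div_div] at h3
    linarith
  · have h1 := (hlox m n).2
    have h2 := Electrification.dist_base_le Y (g ^ m • x₀) (g ^ n • x₀)
    have h3 : K * dist m n ≤ K * Λ * dist m n := by
      gcongr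
      exact le_mul_of_one_le_right hK0.le hΛ1
    change dist (Electrification.base (g ^ m • x₀) : Electrification Y.sets)
      (.base (g ^ n • x₀)) ≤ _
    linarith
  · set R : ℝ := Λ * r + E + c with hR
    set F : ℝ := E / 2 + 2 * δ + M with hF
    set D : ℝ := R + F + (Λ * (r + R + F) + (E + 2 * c))
    -- An `h` that moves `p ∈ α` by less than `r` in the electrification moves it by a bounded amount
    -- in `X`, provided that `π (h p)` is close to `hα`.
    have hmove : ∀ p ∈ Set.range α, ∀ h : G,
        dist (Electrification.base p : Electrification Y.sets) (.base (h • p)) < r →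
        dist p (π (h • p)) ≤ R ∧
        ((∃ v, dist (h⁻¹ • π (h • p)) (α v) ≤ F) → dist p (h • p) ≤ D) := by
      intro p hp h hr
      have h1 : dist p (π (h • p)) ≤ R := by
        have h2 := hproj p (h • p)
        have h3 := hπ_self p hp
        have h4 := dist_triangle p (π p) (π (h • p))
        have h5 := mul_le_mul_of_nonneg_left hr.le hΛ0.le
        linarith
      refine ⟨h1, ?_⟩
      rintro ⟨v, hv⟩
      have hv' : dist (π (h • p)) (h • α v) ≤ F := by
        rwa [← dist_smul h, smul_inv_smul] at hv
      have h2 : dist p (h • α v) ≤ R + F := by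
        linarith [dist_triangle p (π (h • p)) (h • α v)]
      have h3 : dist (Electrification.base p : Electrification Y.sets) (.base (α v)) ≤
          r + R + F := by
        have h4 := Electrification.dist_base_le Y p (h • α v)
        have h5 := dist_triangle_left (Electrification.base (h • p) : Electrification Y.sets)
          (.base (h • α v)) (.base p)
        have h6 : dist (Electrification.base (h • p) : Electrification Y.sets)
          (.base (h • α v)) = dist (Electrification.base p : Electrification Y.sets) (.base (α v)) :=
          dist_smul h (Electrification.base p : Electrification Y.sets) (.base (α v))
        linarith
      have h4 := hemb p hp (α v) ⟨v, rfl⟩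
      have h5 := mul_le_mul_of_nonneg_left h3 hΛ0.le
      have h6 := dist_triangle p (h • α v) (h • p)
      rw [dist_smul, dist_comm (α v)] at h6
      linarith
    obtain ⟨R', hR'⟩ := hδ.exists_dist_zpow_smul_le hgeod hg.1 x₀ D
    obtain ⟨N₀, hN₀⟩ := hg.2 (max (max D R') 0 + 1) (by positivity) x₀
    -- `N` is so large that the projections of `h x₀` and `h gᴺ x₀` are far apart.
    obtain ⟨N₁, hN₁⟩ := exists_nat_gt (K * (2 * R + E + b))
    refine ⟨max N₀ N₁, hN₀.subset ?_⟩
    set N := max N₀ N₁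
    rintro h ⟨h1 : dist (Electrification.base x₀ : Electrification Y.sets) (.base (h • x₀)) < r,
      h2 : dist (Electrification.base (g ^ N • x₀) : Electrification Y.sets)
        (.base (h • g ^ N • x₀)) < r⟩
    obtain ⟨p1, p2⟩ := hmove _ ⟨0, rfl⟩ h h1
    obtain ⟨q1, q2⟩ := hmove _ (hx₀' N) h h2
    set u := h • x₀ with hu
    set v := h • g ^ N • x₀ with hv
    have hfar : E < dist (π u) (π v) := by
      have h3 := (hlox 0 N).1
      simp only [zpow_zero, one_smul, zpow_natCast] at h3
      have h4 := dist_triangle4 x₀ (π u) (π v) (g ^ N • x₀)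
      rw [dist_comm (π v) (g ^ N • x₀)] at h4
      have h5 : (N₁ : ℝ) ≤ N := by exact_mod_cast le_max_right _ _
      have h6 : 2 * R + E + b < dist (0 : ℤ) N / K := by
        rw [lt_div_iff₀ hK0, Int.dist_eq, Int.cast_zero, zero_sub, abs_neg, Int.cast_natCast,
          abs_of_nonneg (by positivity)]
        linarith
      linarith
    have hcontr := hE u v hfar
    -- Points that nearly lie between `u` and `v` are, after translation by `h⁻¹`, near `α`.
    have hnear : ∀ w, dist u w + dist w v ≤ dist u v + E → ∃ s, dist (h⁻¹ • w) (α s) ≤ F := by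
      intro w hw
      obtain ⟨s, hs⟩ := hx₀' N
      have hprod : ∀ x y : X, dist (h⁻¹ • w) x = dist w (h • x) := fun x _ => by
        rw [← dist_smul h, smul_inv_smul]
      have hgp : gromovProduct (h⁻¹ • w) x₀ (g ^ N • x₀) ≤ E / 2 := by
        unfold gromovProduct
        rw [hprod x₀ x₀, hprod (g ^ N • x₀) x₀, ← dist_smul h x₀, dist_comm w]
        linarith
      have hcase : ∀ a b : ℝ, a ≤ b → gromovProduct (h⁻¹ • w) (α a) (α b) ≤ E / 2 →
          ∃ s, dist (h⁻¹ • w) (α s) ≤ F := by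
        intro a b hab hgp
        obtain ⟨γ, L, hγ⟩ := hgeod (α a) (α b)
        obtain ⟨t, ht, h3⟩ := hδ.exists_dist_le_gromovProduct hγ (h⁻¹ • w)
        obtain ⟨s, _, h4⟩ := hM a b hab γ L hγ t ht
        exact ⟨s, by linarith [dist_triangle (h⁻¹ • w) (γ t) (α s)]⟩
      rw [← hs] at hgp
      rcases le_total 0 s with h0 | h0
      · exact hcase 0 s h0 hgp
      · refine hcase s 0 h0 ?_
        unfold gromovProduct at hgp ⊢
        rw [dist_comm (α s), add_comm (dist _ (α s))]
        exact hgp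
    have hx := p2 (hnear _ (by linarith [dist_triangle (π u) (π v) v]))
    have hy := q2 (hnear _ (by linarith [dist_triangle u (π u) (π v), dist_comm (π v) v]))
    have hm := hR' N₀ N (le_max_left _ _) h hx hy
    have l1 := le_max_left D R'
    have l2 := le_max_right D R'
    have l3 := le_max_left (max D R') 0
    exact ⟨by linarith, by linarith⟩
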